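/- Let $\mathbb{F}$ be a non-zero measure on $\mathbb{R}$, finite on bounded sets and concentrated on $(0,\infty)$, and let $F(z)=\mathbb{F}((0,z])$ for $z\ge 0$. Let $\eta$ be a Poisson process on $\mathbb{R}^2\times(0,\infty)$ with intensity measure $\nu_2\times\mathbb{F}$, where $\nu_2$ is Lebesgue measure on $\mathbb{R}^2$. For $(x,h)\in\eta$ let $$C((x,h),\eta)=\{y\in\mathbb{R}^2:\ \|y-x\|^2+h\le\|y-x'\|^2+h'\ \text{ for all }(x',h')\in\eta\}$$ be its Laguerre cell. For Borel sets $A\subseteq\mathbb{R}$ define the volume-biased weight distribution $$\mathbb{F}^V(A)=\mathbb{E}\Big(\sum_{(x,h)\in\eta}\mathbf{1}_{[0,1]^2}(x)\,\mathbf{1}_A(h)\,\nu_2\big(C((x,h),\eta)\big)\Big),$$ and let $F^V(z)=\mathbb{F}^V((0,z])$. Then $\mathbb{F}^V$ is a probability measure on $\mathbb{R}$, and for every $z\ge 0$ $$F^V(z)=1-\exp\Big(-\pi\int_0^z F(t)\,dt\Big)+\pi F(z)\int_z^\infty\exp\Big(-\pi\int_0^u F(t)\,dt\Big)\,du,$$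 where the integral over $(z,\infty)$ is finite. -/

import Mathlib

open MeasureTheory ProbabilityTheory Set
open scoped ENNReal

noncomputable section

/-! ### Point processes and Poisson processes -/

/-- A locally finite counting measure on a metric space `X`: its values are integers or infinity,
and bounded Borel sets have finite measure. -/
structure IsLocallyFiniteCounting {X : Type*} [PseudoMetricSpace X] [MeasurableSpace X]
    (μ : Measure X) : Prop where
  integer_valued : ∀ B : Set X, MeasurableSet B → ∃ n : ℕ∞, μ B = (n : ℝ≥0∞)
  finite_of_bounded : ∀ B : Set X, MeasurableSet B → Bornology.IsBounded B → μ B < ∞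

/-- The space `N(X)` of locally finite counting measures on `X`. As a subtype of `Measure X` it
carries the smallest `σ`-algebra that makes all evaluations `μ ↦ μ B`, `B` measurable,
measurable. -/
abbrev CountingConfig (X : Type*) [PseudoMetricSpace X] [MeasurableSpace X] : Type _ :=
  {μ : Measure X // IsLocallyFiniteCounting μ}

/-- The set of points of a counting measure: its support. -/
def CountingConfig.points {X : Type*} [PseudoMetricSpace X] [MeasurableSpace X]
    (μ : CountingConfig X) : Set X :=
  (μ : Measure X).support

/-- The sum `∑_{p ∈ μ} f p` over the points of a counting measure `μ = ∑ᵢ δ_{pᵢ}`, that is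
`∑ᵢ f pᵢ = ∫ f dμ`. -/
def CountingConfig.sumOver {X : Type*} [PseudoMetricSpace X] [MeasurableSpace X]
    (μ : CountingConfig X) (f : X → ℝ≥0∞) : ℝ≥0∞ :=
  ∫⁻ p, f p ∂(μ : Measure X)

/-- `η` is a Poisson process on `X` with intensity measure `Λ`: a random locally finite counting
measure such that `η(B)` is Poisson distributed with mean `Λ(B)` for every measurable `B` (which
means `η(B) = ∞` almost surely if `Λ(B) = ∞`), and such that the values on pairwise disjoint
measurable sets are independent. -/
structure IsPoissonProcess {Ω X : Type*} [MeasurableSpace Ω] [PseudoMetricSpace X]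
    [MeasurableSpace X] (η : Ω → CountingConfig X) (Λ : Measure X) (P : Measure Ω) : Prop where
  measurable : Measurable η
  poisson_of_finite : ∀ B : Set X, MeasurableSet B → Λ B < ∞ →
    P.map (fun ω => (η ω : Measure X) B) =
      (poissonMeasure (Λ B).toNNReal).map (fun n : ℕ => (n : ℝ≥0∞))
  poisson_of_infinite : ∀ B : Set X, MeasurableSet B → Λ B = ∞ →
    ∀ᵐ ω ∂P, (η ω : Measure X) B = ∞
  independent : ∀ (m : ℕ) (B : Fin m → Set X), (∀ i, MeasurableSet (B i)) →
    Pairwise (fun i j => Disjoint (B i) (B j)) →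
    iIndepFun (fun (i : Fin m) (ω : Ω) => (η ω : Measure X) (B i)) P

/-! ### Laguerre cells and the volume-biased weight distribution -/

/-- The space `ℝ^d × (0,∞)` of weighted points `(x,h)`. -/
abbrev WeightedPoint (d : ℕ) : Type := EuclideanSpace ℝ (Fin d) × Ioi (0 : ℝ)

/-- The Laguerre cell `C((x,h),φ)`: all `y` with `‖y - x‖² + h ≤ ‖y - x'‖² + h'` for every
`(x',h') ∈ φ`. -/
def laguerreCell {d : ℕ} (p : WeightedPoint d) (φ : Set (WeightedPoint d)) :
    Set (EuclideanSpace ℝ (Fin d)) :=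
  {y | ∀ q ∈ φ, ‖y - p.1‖ ^ 2 + (p.2 : ℝ) ≤ ‖y - q.1‖ ^ 2 + (q.2 : ℝ)}

/-- The product `ν_d × 𝔽` of Lebesgue measure on `ℝ^d` and (the restriction to `(0,∞)` of) a
measure `𝔽` on the real line, as a measure on `ℝ^d × (0,∞)`. -/
def weightedIntensity (d : ℕ) (𝔽 : Measure ℝ) : Measure (WeightedPoint d) :=
  (volume : Measure (EuclideanSpace ℝ (Fin d))).prod (𝔽.comap Subtype.val)

/-- The unit cube `[0,1]^d`. -/
def unitCube (d : ℕ) : Set (EuclideanSpace ℝ (Fin d)) :=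
  {x | ∀ i, x i ∈ Icc (0 : ℝ) 1}

/-- The volume-biased weight distribution as a set function on the Borel sets of the line,
`𝔽^V(A) = E ∑_{(x,h) ∈ η} 1_{[0,1]^d}(x) 1_A(h) ν_d(C((x,h),η))`. -/
def volumeBiasedWeight {Ω : Type*} [MeasurableSpace Ω] {d : ℕ}
    (η : Ω → CountingConfig (WeightedPoint d)) (P : Measure Ω) (A : Set ℝ) : ℝ≥0∞ :=
  ∫⁻ ω, (η ω).sumOver (fun p =>
    (unitCube d).indicator 1 p.1 * A.indicator 1 (p.2 : ℝ) *
      volume (laguerreCell p (η ω).points)) ∂P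

/-- The distribution function `F(z) = 𝔽((0,z])`. -/
def weightCDF (𝔽 : Measure ℝ) (z : ℝ) : ℝ :=
  (𝔽 (Ioc 0 z)).toReal

/-- The distribution function `F^V(z) = 𝔽^V((0,z])`. -/
def volumeBiasedCDF {Ω : Type*} [MeasurableSpace Ω] {d : ℕ}
    (η : Ω → CountingConfig (WeightedPoint d)) (P : Measure Ω) (z : ℝ) : ℝ :=
  (volumeBiasedWeight η P (Ioc 0 z)).toReal

end

/-!
The expected area of Laguerre cells is computed by exchanging the order of integration. A point `y`
of the plane lies in the cell of `p ∈ η` iff no point of `η` has a smaller power distance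
`‖y - x‖² + h` to `y` than `p` has, that is, iff `p` minimises `powerDist y` over `η`. Hence
`𝔽^V(A)` is the integral over `y` of the expected number of minimisers of `powerDist y` with
position in the unit square and weight in `A`.

For a Poisson process with intensity `Λ` and a function `T` with `Λ {T < s} < ∞`, the expected
number of minimisers of `T` in `B` is `∫_B exp (-Λ {q | T q < T p}) Λ(dp)`
(`IsPoissonProcess.lintegral_minimal_points`). This would follow from the Mecke formula, but it has
an elementary proof: if `T p` is replaced by its dyadic approximation `r ≤ T p` from below, the
points `p` with a given value of `r` lie outside `{q | T q < r}`, so the independence of the process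
on disjoint sets gives the formula, and dominated convergence passes to the limit.

For `T = powerDist y` in the plane, `{q | T q < s}` is a paraboloid of intensity `π ∫₀ˢ F`
(`weightedIntensity_powerDist_lt`), and `y ↦ ‖y‖²` carries the area measure to `π` times Lebesgue
measure on the half-line (`lintegral_comp_norm_sq`). So `𝔽^V` has the density
`π ∫ₕ^∞ exp (-π ∫₀ᵘ F) du` with respect to `𝔽` (`volumeBiasedWeight_eq_lintegral`). Integration over
`h ∈ (0, z]`, with Tonelli's theorem, gives `π ∫₀^∞ F(min u z) exp (-π ∫₀ᵘ F) du`; on `(0, z]` the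
integrand is the derivative of `-exp (-π ∫₀ᵘ F)` outside the countably many jumps of `F`, and on
`(z, ∞)` the factor `F(z)` is constant. The total mass is one because `F` is bounded below by a
positive constant near infinity, which makes `exp (-π ∫₀ᵘ F)` decay exponentially.
-/

open Filter Topology

/-! ### Dyadic discretisation from below -/

section Dyadic

variable {X : Type*} [MeasurableSpace X]

/-- The largest integer multiple of `2⁻ⁿ` that does not exceed `s`. -/
noncomputable def dyadicFloor (n : ℕ) (s : ℝ) : ℝ := ⌊2 ^ n * s⌋ / 2 ^ n

lemma dyadicFloor_le (n : ℕ) (s : ℝ) : dyadicFloor n s ≤ s := by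
  rw [dyadicFloor, div_le_iff₀' (by positivity)]
  exact Int.floor_le _

lemma monotone_dyadicFloor (s : ℝ) : Monotone fun n ↦ dyadicFloor n s := by
  refine monotone_nat_of_le_succ fun n ↦ ?_
  have h2 : (2 * ⌊2 ^ n * s⌋ : ℝ) ≤ ⌊2 ^ (n + 1) * s⌋ := by
    have : 2 * ⌊2 ^ n * s⌋ ≤ ⌊2 ^ (n + 1) * s⌋ := by
      rw [Int.le_floor]
      push_cast
      have := Int.floor_le (2 ^ n * s)
      rw [pow_succ]
      linarith
    exact_mod_cast this
  rw [dyadicFloor, dyadicFloor, div_le_div_iff₀ (by positivity) (by positivity), pow_succ]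
  have : (0 : ℝ) < 2 ^ n := by positivity
  rw [pow_succ] at h2
  nlinarith

lemma exists_lt_dyadicFloor {t s : ℝ} (h : t < s) : ∃ n, t < dyadicFloor n s := by
  obtain ⟨n, hn⟩ := exists_pow_lt_of_lt_one (sub_pos.2 h) (show (1 / 2 : ℝ) < 1 by norm_num)
  refine ⟨n, ?_⟩
  rw [dyadicFloor, lt_div_iff₀' (by positivity)]
  have h1 := Int.lt_floor_add_one (2 ^ n * s)
  rw [one_div, inv_pow, inv_lt_iff_one_lt_mul₀' (by positivity)] at hn
  linarith

lemma measurable_dyadicFloor (n : ℕ) : Measurable (dyadicFloor n) := by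
  unfold dyadicFloor
  fun_prop

lemma tendsto_measure_lt_dyadicFloor (μ : Measure X) (T : X → ℝ) (s : ℝ) :
    Tendsto (fun n ↦ μ {q | T q < dyadicFloor n s}) atTop (𝓝 (μ {q | T q < s})) := by
  have h : {q | T q < s} = ⋃ n, {q | T q < dyadicFloor n s} := by
    ext q
    simp only [mem_ofPred_eq, mem_iUnion]
    exact ⟨exists_lt_dyadicFloor, fun ⟨n, hn⟩ ↦ hn.trans_le (dyadicFloor_le n s)⟩
  rw [h]
  exact tendsto_measure_iUnion_atTop fun m n hmn q hq ↦
    lt_of_lt_of_le hq (monotone_dyadicFloor s hmn)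

/-- Although `1_{0}` is discontinuous at `0`, it can be interchanged with this limit, because the
masses increase to their limit. -/
lemma tendsto_indicator_measure_lt_dyadicFloor (μ : Measure X) (T : X → ℝ) (s : ℝ) :
    Tendsto (fun n ↦ ({0} : Set ℝ≥0∞).indicator (1 : ℝ≥0∞ → ℝ≥0∞)
        (μ {q | T q < dyadicFloor n s})) atTop
      (𝓝 (({0} : Set ℝ≥0∞).indicator 1 (μ {q | T q < s}))) := by
  by_cases h0 : μ {q | T q < s} = 0
  · have : ∀ n, μ {q | T q < dyadicFloor n s} = 0 := fun n ↦
      measure_mono_null (fun q hq ↦ lt_of_lt_of_le hq (dyadicFloor_le n s)) h0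
    simp [this, h0]
  · refine tendsto_const_nhds.congr' ?_
    filter_upwards [(tendsto_measure_lt_dyadicFloor μ T s).eventually_ne h0] with n hn
    simp [h0, hn]

lemma lintegral_comp_dyadicFloor (μ : Measure X) {T : X → ℝ} (hT : Measurable T) {B : Set X}
    (n : ℕ) (g : ℝ → ℝ≥0∞) :
    ∫⁻ p in B, g (dyadicFloor n (T p)) ∂μ
      = ∑' k : ℤ, g (k / 2 ^ n) * μ ({p | ⌊2 ^ n * T p⌋ = k} ∩ B) := by
  have hm : Measurable fun p ↦ ⌊2 ^ n * T p⌋ := by fun_prop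
  have h1 := lintegral_map (μ := μ.restrict B) (f := fun k : ℤ ↦ g (k / 2 ^ n))
    (measurable_of_countable _) hm
  rw [lintegral_countable'] at h1
  rw [show ∫⁻ p in B, g (dyadicFloor n (T p)) ∂μ
    = ∫⁻ p in B, g (⌊2 ^ n * T p⌋ / 2 ^ n) ∂μ from rfl, ← h1]
  congr 1 with k
  rw [Measure.map_apply hm (measurableSet_singleton k),
    Measure.restrict_apply (hm (measurableSet_singleton k))]
  rfl

lemma measurable_measure_lt (μ : Measure X) (T : X → ℝ) : Measurable fun s ↦ μ {q | T q < s} :=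
  Monotone.measurable fun _ _ hst ↦ measure_mono fun _ hq ↦ lt_of_lt_of_le hq hst

end Dyadic

/-! ### Kernels of finite measures -/

lemma isSFiniteKernel_of_isFiniteMeasure {Ω X : Type*} [MeasurableSpace Ω] [MeasurableSpace X]
    {κ : Kernel Ω X} (hκ : ∀ ω, κ ω univ < ∞) :
    IsSFiniteKernel κ := by
  classical
  -- The total masses need not be bounded: `Ω` is split according to the integer part of the mass.
  let S : ℕ → Set Ω := fun n ↦ {ω | ⌊(κ ω univ).toReal⌋₊ = n}
  have hS : ∀ n, MeasurableSet (S n) := fun n ↦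
    (Nat.measurable_floor.comp (κ.measurable_coe MeasurableSet.univ).ennreal_toReal)
      (measurableSet_singleton n)
  have hsum : κ = Kernel.sum fun n ↦ Kernel.piecewise (hS n) κ 0 := by
    ext ω B hB
    rw [Kernel.sum_apply' _ _ hB, tsum_eq_single ⌊(κ ω univ).toReal⌋₊]
    · simp [Kernel.piecewise_apply, S]
    · intro n hn
      rw [Kernel.piecewise_apply, if_neg (fun hmem ↦ hn hmem.symm)]
      simp
  rw [hsum]
  have hfin : ∀ n, IsFiniteKernel (Kernel.piecewise (hS n) κ 0) := fun n ↦ by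
    refine ⟨⟨n + 1, by finiteness, fun ω ↦ ?_⟩⟩
    rw [Kernel.piecewise_apply]
    split_ifs with hω
    · have h1 := (Nat.lt_floor_add_one (κ ω univ).toReal).le
      rw [show ⌊(κ ω univ).toReal⌋₊ = n from hω] at h1
      rw [← ENNReal.ofReal_toReal (hκ ω).ne]
      refine (ENNReal.ofReal_le_ofReal h1).trans ?_
      rw [ENNReal.ofReal_add (by positivity) zero_le_one]
      simp
    · simp
  infer_instance

/-! ### Void probabilities and means of a Poisson process -/

/-- `exp (-a)` for an extended nonnegative real `a`, again as an extended nonnegative real.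
At `a = ∞` the junk value `∞.toReal = 0` makes it equal to `1`; it is used for finite `a` only. -/
noncomputable def expNeg (a : ℝ≥0∞) : ℝ≥0∞ := ENNReal.ofReal (Real.exp (-a.toReal))

lemma expNeg_le_one (a : ℝ≥0∞) : expNeg a ≤ 1 := by
  rw [expNeg, ENNReal.ofReal_le_one, Real.exp_le_one_iff]
  simp

lemma measurable_expNeg : Measurable expNeg := by
  unfold expNeg
  fun_prop

lemma lintegral_natCast_poissonMeasure (r : NNReal) :
    ∫⁻ n, (n : ℝ≥0∞) ∂(poissonMeasure r) = r := by
  have h : HasSum (fun n : ℕ ↦ Real.exp (-r) * (r : ℝ) ^ n / (n.factorial : ℕ) * (n : ℝ)) r := by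
    have h1 := (hasSum_one_poissonMeasure r).mul_left (r : ℝ)
    rw [mul_one] at h1
    rw [← hasSum_nat_add_iff' 1]
    simp only [Finset.range_one, Finset.sum_singleton, Nat.cast_zero, mul_zero, sub_zero]
    refine Eq.subst (motive := fun f : ℕ → ℝ ↦ HasSum f r) (funext fun n ↦ ?_) h1
    rw [Nat.factorial_succ]
    push_cast
    field_simp
    exact (pow_succ' _ n).symm
  rw [lintegral_countable', ← ENNReal.ofReal_coe_nnreal, ← h.tsum_eq,
    ENNReal.ofReal_tsum_of_nonneg (fun n ↦ by positivity) h.summable]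
  congr 1 with n
  rw [poissonMeasure_singleton, ENNReal.ofReal_mul (by positivity), mul_comm]
  simp

section Poisson

variable {Ω X : Type*} [MeasurableSpace Ω] [PseudoMetricSpace X] [MeasurableSpace X]
  {P : Measure Ω} {η : Ω → CountingConfig X} {Λ : Measure X}

lemma measurable_coe_config (hη : Measurable η) : Measurable fun ω ↦ (η ω : Measure X) :=
  measurable_subtype_coe.comp hη

lemma measurable_config_apply (hη : Measurable η) {B : Set X} (hB : MeasurableSet B) :
    Measurable fun ω ↦ (η ω : Measure X) B :=
  (Measure.measurable_coe hB).comp (measurable_coe_config hη)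

namespace IsPoissonProcess

lemma lintegral_apply (h : IsPoissonProcess η Λ P) {B : Set X} (hB : MeasurableSet B)
    (hfin : Λ B < ∞) : ∫⁻ ω, (η ω : Measure X) B ∂P = Λ B := by
  have h1 : ∫⁻ ω, (η ω : Measure X) B ∂P
      = ∫⁻ a, a ∂(P.map (fun ω => (η ω : Measure X) B)) :=
    (lintegral_map measurable_id (measurable_config_apply h.measurable hB)).symm
  rw [h1, h.poisson_of_finite B hB hfin, lintegral_map (f := fun a ↦ a) measurable_id (by fun_prop)]
  rw [lintegral_natCast_poissonMeasure, ENNReal.coe_toNNReal hfin.ne]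

lemma measure_apply_eq_zero (h : IsPoissonProcess η Λ P) {B : Set X} (hB : MeasurableSet B)
    (hfin : Λ B < ∞) : P {ω | (η ω : Measure X) B = 0} = expNeg (Λ B) := by
  have h1 : P {ω | (η ω : Measure X) B = 0}
      = P.map (fun ω => (η ω : Measure X) B) {0} := by
    rw [Measure.map_apply (measurable_config_apply h.measurable hB) (measurableSet_singleton _)]
    rfl
  rw [h1, h.poisson_of_finite B hB hfin, Measure.map_apply (by fun_prop)
    (measurableSet_singleton _)]
  have h2 : (fun n : ℕ ↦ (n : ℝ≥0∞)) ⁻¹' {0} = {0} := by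
    ext n
    simp
  rw [h2, poissonMeasure_singleton]
  simp [expNeg, ENNReal.toReal]

/-- The independence of the process on the disjoint sets `D` and `H` separates the number of points
in `D` from the event that `H` is empty. -/
lemma lintegral_indicator_mul (h : IsPoissonProcess η Λ P) {D H : Set X} (hD : MeasurableSet D)
    (hH : MeasurableSet H) (hDH : Disjoint D H) (hDfin : Λ D < ∞) (hHfin : Λ H < ∞) :
    ∫⁻ ω, ({0} : Set ℝ≥0∞).indicator 1 ((η ω : Measure X) H) * (η ω : Measure X) D ∂P
      = expNeg (Λ H) * Λ D := by
  have hmeas : ∀ i, MeasurableSet (![H, D] i) := by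
    intro i
    fin_cases i
    exacts [hH, hD]
  have hdisj : Pairwise fun i j ↦ Disjoint (![H, D] i) (![H, D] j) := by
    intro i j hij
    fin_cases i <;> fin_cases j
    · exact absurd rfl hij
    · exact hDH.symm
    · exact hDH
    · exact absurd rfl hij
  have hind := (h.independent 2 ![H, D] hmeas hdisj).indepFun (show (0 : Fin 2) ≠ 1 by decide)
  have hg : Measurable (({0} : Set ℝ≥0∞).indicator (1 : ℝ≥0∞ → ℝ≥0∞)) :=
    measurable_one.indicator (measurableSet_singleton 0)
  have hmH := measurable_config_apply h.measurable hH
  have hmD := measurable_config_apply h.measurable hD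
  have := lintegral_mul_eq_lintegral_mul_lintegral_of_indepFun (hg.comp hmH) hmD
    (hind.comp hg measurable_id)
  refine this.trans ?_
  rw [h.lintegral_apply hD hDfin, ← h.measure_apply_eq_zero hH hHfin]
  congr 1
  exact lintegral_indicator_one (hmH (measurableSet_singleton 0))

end IsPoissonProcess

/-! ### Random counting measures as s-finite kernels -/

/-- A random locally finite measure, regarded as a transition kernel. -/
noncomputable def configKernel (hη : Measurable η) : Kernel Ω X :=
  ⟨fun ω ↦ (η ω : Measure X), measurable_coe_config hη⟩

lemma isSFiniteKernel_configKernel [OpensMeasurableSpace X] (hη : Measurable η) :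
    IsSFiniteKernel (configKernel hη) := by
  rcases isEmpty_or_nonempty X with hX | ⟨⟨x₀⟩⟩
  · exact isSFiniteKernel_of_isFiniteMeasure fun ω ↦ by simp [Set.univ_eq_empty_iff.2 hX]
  let f : X → ℕ := fun x ↦ ⌊dist x x₀⌋₊
  have hf : Measurable f :=
    Nat.measurable_floor.comp (continuous_id.dist continuous_const).measurable
  have hA : ∀ n, MeasurableSet (f ⁻¹' {n}) := fun n ↦ hf (measurableSet_singleton n)
  have hsum : configKernel hη = Kernel.sum fun n ↦ (configKernel hη).restrict (hA n) := by
    ext ω B hB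
    rw [Kernel.sum_apply' _ _ hB]
    simp_rw [Kernel.restrict_apply' _ (hA _) _ hB]
    rw [← measure_iUnion]
    · congr 1
      ext x
      simp
    · intro m n hmn
      refine Set.disjoint_left.2 fun x hx hx' ↦ hmn ?_
      exact hx.2.symm.trans hx'.2
    · exact fun n ↦ hB.inter (hA n)
  rw [hsum]
  have hfin : ∀ n, IsSFiniteKernel ((configKernel hη).restrict (hA n)) := fun n ↦ by
    refine isSFiniteKernel_of_isFiniteMeasure fun ω ↦ ?_
    rw [Kernel.restrict_apply' _ (hA _) _ MeasurableSet.univ, univ_inter]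
    refine (η ω).2.finite_of_bounded _ (hA n) ((Metric.isBounded_iff_subset_closedBall x₀).2
      ⟨n + 1, fun x hx ↦ ?_⟩)
    have h1 := (Nat.lt_floor_add_one (dist x x₀)).le
    rw [show ⌊dist x x₀⌋₊ = n from hx] at h1
    exact h1
  infer_instance

/-- Joint measurability, in the configuration, the point `p` and a parameter `y`, of the number of
points `q` with `T y q < T y p`. -/
lemma measurable_config_lt [OpensMeasurableSpace X] {Y : Type*} [MeasurableSpace Y]
    (hη : Measurable η) {T : Y → X → ℝ} (hT : Measurable fun z : Y × X ↦ T z.1 z.2) :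
    Measurable fun z : (Ω × Y) × X ↦ (η z.1.1 : Measure X) {q | T z.1.2 q < T z.1.2 z.2} := by
  have := isSFiniteKernel_configKernel hη
  let κ : Kernel ((Ω × Y) × X) X :=
    (configKernel hη).comap (fun z ↦ z.1.1) (measurable_fst.comp measurable_fst)
  have ht : MeasurableSet {w : ((Ω × Y) × X) × X | T w.1.1.2 w.2 < T w.1.1.2 w.1.2} :=
    measurableSet_lt (hT.comp (by fun_prop : Measurable fun w : ((Ω × Y) × X) × X ↦
      (w.1.1.2, w.2))) (hT.comp (by fun_prop : Measurable fun w : ((Ω × Y) × X) × X ↦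
      (w.1.1.2, w.1.2)))
  exact Kernel.measurable_kernel_prodMk_left (κ := κ) ht

lemma measurable_lintegral_minimal_points [OpensMeasurableSpace X] {Y : Type*} [MeasurableSpace Y]
    (hη : Measurable η) {T : Y → X → ℝ} (hT : Measurable fun z : Y × X ↦ T z.1 z.2) {B : Set X}
    (hB : MeasurableSet B) :
    Measurable fun z : Ω × Y ↦ ∫⁻ p in B, ({0} : Set ℝ≥0∞).indicator 1
      ((η z.1 : Measure X) {q | T z.2 q < T z.2 p}) ∂(η z.1 : Measure X) := by
  have := isSFiniteKernel_configKernel hη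
  let κ : Kernel (Ω × Y) X :=
    ((configKernel hη).restrict hB).comap Prod.fst measurable_fst
  have hg : Measurable (({0} : Set ℝ≥0∞).indicator (1 : ℝ≥0∞ → ℝ≥0∞)) :=
    measurable_one.indicator (measurableSet_singleton 0)
  exact (hg.comp (measurable_config_lt hη hT)).lintegral_kernel_prod_right' (κ := κ)

/-! ### The expected number of minimal points -/

namespace IsPoissonProcess

/-- The formula for the expected number of minimal points with the bound `T p` in
`{q | T q < T p}` replaced by its dyadic approximation from below. The points of `B` in the slab
`k ≤ 2ⁿ T p < k + 1` are then counted only if the disjoint set `{q | T q < k / 2ⁿ}` is empty, so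
independence applies slab by slab. -/
lemma lintegral_minimal_points_dyadic (h : IsPoissonProcess η Λ P) {T : X → ℝ} (hT : Measurable T)
    (hfin : ∀ s, Λ {q | T q < s} < ∞) {B : Set X} (hB : MeasurableSet B) (hBfin : Λ B < ∞)
    (n : ℕ) :
    ∫⁻ ω, ∫⁻ p in B, ({0} : Set ℝ≥0∞).indicator 1
        ((η ω : Measure X) {q | T q < dyadicFloor n (T p)}) ∂(η ω : Measure X) ∂P
      = ∫⁻ p in B, expNeg (Λ {q | T q < dyadicFloor n (T p)}) ∂Λ := by
  have hD : ∀ k : ℤ, MeasurableSet ({p | ⌊2 ^ n * T p⌋ = k} ∩ B) := fun k ↦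
    ((by fun_prop : Measurable fun p ↦ ⌊2 ^ n * T p⌋) (measurableSet_singleton k)).inter hB
  have hH : ∀ s : ℝ, MeasurableSet {q | T q < s} := fun s ↦ measurableSet_lt hT measurable_const
  have hg : Measurable (({0} : Set ℝ≥0∞).indicator (1 : ℝ≥0∞ → ℝ≥0∞)) :=
    measurable_one.indicator (measurableSet_singleton 0)
  have h1 : ∀ ω, ∫⁻ p in B, ({0} : Set ℝ≥0∞).indicator 1
        ((η ω : Measure X) {q | T q < dyadicFloor n (T p)}) ∂(η ω : Measure X)
      = ∑' k : ℤ, ({0} : Set ℝ≥0∞).indicator 1 ((η ω : Measure X) {q | T q < k / 2 ^ n})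
        * (η ω : Measure X) ({p | ⌊2 ^ n * T p⌋ = k} ∩ B) := fun ω ↦
    lintegral_comp_dyadicFloor _ hT n fun s ↦
      ({0} : Set ℝ≥0∞).indicator 1 ((η ω : Measure X) {q | T q < s})
  rw [lintegral_comp_dyadicFloor Λ hT n fun s ↦ expNeg (Λ {q | T q < s})]
  simp_rw [h1]
  refine (lintegral_tsum fun k ↦ ((hg.comp (measurable_config_apply h.measurable (hH _))).mul
    (measurable_config_apply h.measurable (hD k))).aemeasurable).trans ?_
  congr 1 with k
  refine h.lintegral_indicator_mul (hD k) (hH _) ?_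
    ((measure_mono inter_subset_right).trans_lt hBfin) (hfin _)
  rw [Set.disjoint_left]
  rintro p ⟨hp, -⟩ hp'
  simp only [mem_ofPred_eq] at hp hp'
  rw [lt_div_iff₀' (by positivity)] at hp'
  have := Int.floor_le (2 ^ n * T p)
  rw [hp] at this
  exact absurd hp' (not_lt.2 this)

/-- The expected number of points `p ∈ B` of a Poisson process at which `T` is minimal over the
whole process. This is the instance of the Mecke formula that the Laguerre cells require; the
independence property gives it for `T` rounded down to multiples of `2⁻ⁿ`, because then `p` and
`{q | T q < T p}` are confined to disjoint sets, and dominated convergence does the rest. -/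
theorem lintegral_minimal_points (h : IsPoissonProcess η Λ P) {T : X → ℝ}
    (hT : Measurable T) (hfin : ∀ s, Λ {q | T q < s} < ∞) {B : Set X} (hB : MeasurableSet B)
    (hBfin : Λ B < ∞) :
    ∫⁻ ω, ∫⁻ p in B, ({0} : Set ℝ≥0∞).indicator 1
        ((η ω : Measure X) {q | T q < T p}) ∂(η ω : Measure X) ∂P
      = ∫⁻ p in B, expNeg (Λ {q | T q < T p}) ∂Λ := by
  have hg : Measurable (({0} : Set ℝ≥0∞).indicator (1 : ℝ≥0∞ → ℝ≥0∞)) :=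
    measurable_one.indicator (measurableSet_singleton 0)
  have hg1 : ∀ a, ({0} : Set ℝ≥0∞).indicator (1 : ℝ≥0∞ → ℝ≥0∞) a ≤ 1 := fun a ↦
    Set.indicator_le_self _ _ a
  have hH : ∀ s : ℝ, MeasurableSet {q | T q < s} := fun s ↦ measurableSet_lt hT measurable_const
  have hmB := measurable_config_apply h.measurable hB
  have hEB := h.lintegral_apply hB hBfin
  have hBη : ∀ᵐ ω ∂P, (η ω : Measure X) B < ∞ :=
    ae_lt_top hmB (by rw [hEB]; exact hBfin.ne)
  have hmeas : ∀ (μ : Measure X) (n : ℕ), Measurable fun p ↦ μ {q | T q < dyadicFloor n (T p)} :=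
    fun μ n ↦ (measurable_measure_lt μ T).comp ((measurable_dyadicFloor n).comp hT)
  have hleft : Tendsto (fun n ↦ ∫⁻ ω, ∫⁻ p in B, ({0} : Set ℝ≥0∞).indicator 1
        ((η ω : Measure X) {q | T q < dyadicFloor n (T p)}) ∂(η ω : Measure X) ∂P) atTop
      (𝓝 (∫⁻ ω, ∫⁻ p in B, ({0} : Set ℝ≥0∞).indicator 1
        ((η ω : Measure X) {q | T q < T p}) ∂(η ω : Measure X) ∂P)) := by
    refine tendsto_lintegral_of_dominated_convergence (fun ω ↦ (η ω : Measure X) B) ?_ ?_ ?_ ?_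
    · intro n
      have : ∀ ω, ∫⁻ p in B, ({0} : Set ℝ≥0∞).indicator 1
            ((η ω : Measure X) {q | T q < dyadicFloor n (T p)}) ∂(η ω : Measure X)
          = ∑' k : ℤ, ({0} : Set ℝ≥0∞).indicator 1 ((η ω : Measure X) {q | T q < k / 2 ^ n})
            * (η ω : Measure X) ({p | ⌊2 ^ n * T p⌋ = k} ∩ B) := fun ω ↦
        lintegral_comp_dyadicFloor _ hT n fun s ↦
          ({0} : Set ℝ≥0∞).indicator 1 ((η ω : Measure X) {q | T q < s})
      simp_rw [this]
      refine Measurable.tsum fun k ↦ (hg.comp (measurable_config_apply h.measurable (hH _))).mul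
        (measurable_config_apply h.measurable (MeasurableSet.inter ?_ hB))
      exact (by fun_prop : Measurable fun p ↦ ⌊2 ^ n * T p⌋) (measurableSet_singleton k)
    · intro n
      refine ae_of_all _ fun ω ↦ ?_
      calc _ ≤ ∫⁻ _ in B, 1 ∂(η ω : Measure X) := lintegral_mono fun p ↦ hg1 _
        _ = _ := by simp
    · rw [hEB]
      exact hBfin.ne
    · filter_upwards [hBη] with ω hω
      refine tendsto_lintegral_of_dominated_convergence (fun _ ↦ 1)
        (fun n ↦ hg.comp (hmeas _ n)) (fun n ↦ ae_of_all _ fun p ↦ hg1 _) ?_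
        (ae_of_all _ fun p ↦ tendsto_indicator_measure_lt_dyadicFloor _ _ _)
      simpa using hω.ne
  have hright : Tendsto (fun n ↦ ∫⁻ p in B, expNeg (Λ {q | T q < dyadicFloor n (T p)}) ∂Λ) atTop
      (𝓝 (∫⁻ p in B, expNeg (Λ {q | T q < T p}) ∂Λ)) := by
    refine tendsto_lintegral_of_dominated_convergence (fun _ ↦ 1)
      (fun n ↦ measurable_expNeg.comp (hmeas _ n))
      (fun n ↦ ae_of_all _ fun p ↦ expNeg_le_one _) (by simpa using hBfin.ne)
      (ae_of_all _ fun p ↦ ?_)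
    refine (ENNReal.continuous_ofReal.tendsto _).comp
      ((Real.continuous_exp.tendsto _).comp (Tendsto.neg ?_))
    exact (ENNReal.tendsto_toReal (hfin _).ne).comp (tendsto_measure_lt_dyadicFloor Λ T (T p))
  refine tendsto_nhds_unique hleft (hright.congr fun n ↦ ?_)
  exact (h.lintegral_minimal_points_dyadic hT hfin hB hBfin n).symm

/-- The finiteness of `Λ B` in `lintegral_minimal_points` is removed by exhaustion. -/
theorem lintegral_minimal_points_of_sigmaFinite [OpensMeasurableSpace X] [SigmaFinite Λ]
    (h : IsPoissonProcess η Λ P) {T : X → ℝ} (hT : Measurable T)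
    (hfin : ∀ s, Λ {q | T q < s} < ∞) {B : Set X} (hB : MeasurableSet B) :
    ∫⁻ ω, ∫⁻ p in B, ({0} : Set ℝ≥0∞).indicator 1
        ((η ω : Measure X) {q | T q < T p}) ∂(η ω : Measure X) ∂P
      = ∫⁻ p in B, expNeg (Λ {q | T q < T p}) ∂Λ := by
  let S : ℕ → Set X := fun n ↦ B ∩ disjointed (spanningSets Λ) n
  have hS : ∀ n, MeasurableSet (S n) := fun n ↦
    hB.inter (MeasurableSet.disjointed (measurableSet_spanningSets Λ) n)
  have hd : Pairwise (Function.onFun Disjoint S) := fun m n hmn ↦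
    (disjoint_disjointed (spanningSets Λ) hmn).mono inter_subset_right inter_subset_right
  have hBS : B = ⋃ n, S n := by
    rw [← inter_iUnion, iUnion_disjointed, iUnion_spanningSets, inter_univ]
  have hSfin : ∀ n, Λ (S n) < ∞ := fun n ↦
    (measure_mono (inter_subset_right.trans (disjointed_subset _ n))).trans_lt
      (measure_spanningSets_lt_top Λ n)
  have hmeas : ∀ n, Measurable fun ω ↦ ∫⁻ p in S n, ({0} : Set ℝ≥0∞).indicator 1
      ((η ω : Measure X) {q | T q < T p}) ∂(η ω : Measure X) := fun n ↦
    (measurable_lintegral_minimal_points h.measurable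
      (T := fun (_ : Unit) p ↦ T p) (hT.comp measurable_snd) (hS n)).comp
      (measurable_id.prodMk (measurable_const (a := ())))
  rw [hBS, lintegral_iUnion hS hd]
  simp_rw [lintegral_iUnion hS hd]
  rw [lintegral_tsum fun n ↦ (hmeas n).aemeasurable]
  exact tsum_congr fun n ↦ h.lintegral_minimal_points hT hfin (hS n) (hSfin n)

end IsPoissonProcess

end Poisson

/-! ### Laguerre cells and the power distance -/

/-- The power distance `‖y - x‖² + h` of `y` to the weighted point `(x, h)`. -/
noncomputable def powerDist {d : ℕ} (y : EuclideanSpace ℝ (Fin d)) (p : WeightedPoint d) : ℝ :=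
  ‖y - p.1‖ ^ 2 + (p.2 : ℝ)

lemma continuous_powerDist {d : ℕ} :
    Continuous fun z : EuclideanSpace ℝ (Fin d) × WeightedPoint d ↦ powerDist z.1 z.2 := by
  unfold powerDist
  fun_prop

lemma continuous_powerDist_right {d : ℕ} (y : EuclideanSpace ℝ (Fin d)) :
    Continuous fun q : WeightedPoint d ↦ powerDist y q := by
  unfold powerDist
  fun_prop

lemma continuous_powerDist_left {d : ℕ} (q : WeightedPoint d) :
    Continuous fun y : EuclideanSpace ℝ (Fin d) ↦ powerDist y q := by
  unfold powerDist
  fun_prop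

lemma measurable_powerDist {d : ℕ} (y : EuclideanSpace ℝ (Fin d)) :
    Measurable (powerDist y) :=
  (continuous_powerDist_right y).measurable

/-- Membership in a Laguerre cell expressed by the counting measure itself instead of its support:
the set of points that beat `p` at `y` is open, so it avoids the support iff it has no mass. -/
lemma mem_laguerreCell_points_iff {d : ℕ} (φ : CountingConfig (WeightedPoint d))
    (p : WeightedPoint d) (y : EuclideanSpace ℝ (Fin d)) :
    y ∈ laguerreCell p φ.points
      ↔ (φ : Measure (WeightedPoint d)) {q | powerDist y q < powerDist y p} = 0 := by
  have hcell : y ∈ laguerreCell p φ.points ↔ {q | powerDist y q < powerDist y p}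
      ⊆ (φ : Measure (WeightedPoint d)).supportᶜ := by
    simp only [Set.subset_def, mem_compl_iff, imp_not_comm (a := _ < _), mem_ofPred_eq, not_lt]
    rfl
  have hopen : IsOpen {q | powerDist y q < powerDist y p} :=
    isOpen_lt (continuous_powerDist_right y) continuous_const
  rw [hcell]
  exact ⟨fun h ↦ measure_mono_null h Measure.measure_compl_support,
    fun h ↦ Measure.subset_compl_support_of_isOpen hopen h⟩

lemma measurableSet_laguerreCell {d : ℕ} (p : WeightedPoint d) (φ : Set (WeightedPoint d)) :
    MeasurableSet (laguerreCell p φ) := by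
  have : laguerreCell p φ = ⋂ q ∈ φ, {y | powerDist y p ≤ powerDist y q} := by
    ext y
    simp [laguerreCell, powerDist]
  rw [this]
  refine (isClosed_biInter fun q _ ↦ isClosed_le (continuous_powerDist_left p)
    (continuous_powerDist_left q)).measurableSet

lemma volume_laguerreCell_points {d : ℕ} (φ : CountingConfig (WeightedPoint d))
    (p : WeightedPoint d) :
    volume (laguerreCell p φ.points) = ∫⁻ y, ({0} : Set ℝ≥0∞).indicator 1
      ((φ : Measure (WeightedPoint d)) {q | powerDist y q < powerDist y p}) := by
  rw [← lintegral_indicator_one (measurableSet_laguerreCell p φ.points)]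
  refine lintegral_congr fun y ↦ ?_
  by_cases hy : y ∈ laguerreCell p φ.points
  · simp [hy, (mem_laguerreCell_points_iff φ p y).1 hy]
  · simp [hy, mt (mem_laguerreCell_points_iff φ p y).2 hy]

lemma measurableSet_unitCube (d : ℕ) : MeasurableSet (unitCube d) := by
  have : unitCube d = ⋂ i, {x | x i ∈ Icc (0 : ℝ) 1} := by
    ext x
    simp [unitCube]
  rw [this]
  exact MeasurableSet.iInter fun i ↦
    (by fun_prop : Measurable fun x : EuclideanSpace ℝ (Fin d) ↦ x i) measurableSet_Icc

lemma volume_unitCube (d : ℕ) : volume (unitCube d) = 1 := by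
  have h : unitCube d = WithLp.ofLp ⁻¹' (Icc (0 : Fin d → ℝ) 1) := by
    ext x
    simp [unitCube, Pi.le_def, forall_and]
  rw [h, (PiLp.volume_preserving_ofLp (Fin d)).measure_preimage measurableSet_Icc.nullMeasurableSet,
    Real.volume_Icc_pi]
  simp

/-! ### The integrated weight distribution function -/

section CDF

variable (𝔽 : Measure ℝ)

lemma weightCDF_nonneg (z : ℝ) : 0 ≤ weightCDF 𝔽 z := ENNReal.toReal_nonneg

lemma integral_weightCDF_nonneg {u : ℝ} (hu : 0 ≤ u) : 0 ≤ ∫ t in (0 : ℝ)..u, weightCDF 𝔽 t :=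
  intervalIntegral.integral_nonneg hu fun t _ ↦ weightCDF_nonneg 𝔽 t

variable [IsLocallyFiniteMeasure 𝔽]

lemma ofReal_weightCDF (z : ℝ) : ENNReal.ofReal (weightCDF 𝔽 z) = 𝔽 (Ioc 0 z) :=
  ENNReal.ofReal_toReal measure_Ioc_lt_top.ne

lemma monotone_weightCDF : Monotone (weightCDF 𝔽) := fun _ _ h ↦
  ENNReal.toReal_mono measure_Ioc_lt_top.ne (measure_mono (Ioc_subset_Ioc_right h))

lemma intervalIntegrable_weightCDF (a b : ℝ) : IntervalIntegrable (weightCDF 𝔽) volume a b :=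
  (monotone_weightCDF 𝔽).intervalIntegrable

lemma continuous_integral_weightCDF : Continuous fun u ↦ ∫ t in (0 : ℝ)..u, weightCDF 𝔽 t :=
  intervalIntegral.continuous_primitive (intervalIntegrable_weightCDF 𝔽) 0

lemma lintegral_sub_eq_integral_weightCDF {s : ℝ} (hs : 0 ≤ s) :
    ∫⁻ h in Ioi 0, ENNReal.ofReal (s - h) ∂𝔽
      = ENNReal.ofReal (∫ t in (0 : ℝ)..s, weightCDF 𝔽 t) := by
  have h1 : ∀ h ∈ Ioi (0 : ℝ), ENNReal.ofReal (s - h)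
      = ∫⁻ t in Ioc 0 s, (Ici h).indicator 1 t := by
    intro h hh
    rw [lintegral_indicator_one measurableSet_Ici, Measure.restrict_apply measurableSet_Ici,
      ← Real.volume_Icc]
    congr 1
    ext t
    simp only [mem_inter_iff, mem_Ici, mem_Ioc, mem_Icc]
    exact ⟨fun ⟨a, b⟩ ↦ ⟨a, hh.trans_le a, b⟩, fun ⟨a, _, b⟩ ↦ ⟨a, b⟩⟩
  rw [setLIntegral_congr_fun measurableSet_Ioi h1, lintegral_lintegral_swap]
  · rw [intervalIntegral.integral_of_le hs, ofReal_integral_eq_lintegral_ofReal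
      (intervalIntegrable_weightCDF 𝔽 0 s).1 (ae_of_all _ (weightCDF_nonneg 𝔽))]
    refine lintegral_congr fun t ↦ ?_
    have h2 : (fun h ↦ (Ici h).indicator (1 : ℝ → ℝ≥0∞) t) = (Iic t).indicator 1 := by
      ext h
      simp [indicator]
    rw [h2, lintegral_indicator_one measurableSet_Iic, Measure.restrict_apply measurableSet_Iic,
      ofReal_weightCDF, Iic_inter_Ioi]
  · refine Measurable.aemeasurable ?_
    exact measurable_one.indicator (measurableSet_le measurable_fst measurable_snd :
      MeasurableSet {z : ℝ × ℝ | z.1 ≤ z.2})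

end CDF

/-! ### Integration of planar radial functions and the mass of paraboloids -/

lemma setOf_norm_sq_lt (d : ℕ) (x : EuclideanSpace ℝ (Fin d)) (r : ℝ) :
    {y | ‖x - y‖ ^ 2 < r} = Metric.ball x √r := by
  ext y
  rw [mem_ball_iff_norm', Real.lt_sqrt (norm_nonneg _)]
  rfl

lemma volume_norm_sq_lt (x : EuclideanSpace ℝ (Fin 2)) (r : ℝ) :
    volume {y | ‖x - y‖ ^ 2 < r} = ENNReal.ofReal Real.pi * ENNReal.ofReal r := by
  rw [setOf_norm_sq_lt, EuclideanSpace.volume_ball_fin_two, mul_comm]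
  rcases le_total 0 r with hr | hr
  · rw [← ENNReal.ofReal_pow (Real.sqrt_nonneg r), Real.sq_sqrt hr]
  · simp [Real.sqrt_eq_zero_of_nonpos hr, ENNReal.ofReal_of_nonpos hr]

/-- Under `y ↦ ‖y‖²` the area measure of the plane becomes `π` times Lebesgue measure on the
half-line. This is where the dimension two matters. -/
lemma map_norm_sq_volume :
    (volume : Measure (EuclideanSpace ℝ (Fin 2))).map (fun y ↦ ‖y‖ ^ 2)
      = ENNReal.ofReal Real.pi • volume.restrict (Ici (0 : ℝ)) := by
  have hm : Measurable fun y : EuclideanSpace ℝ (Fin 2) ↦ ‖y‖ ^ 2 := by fun_prop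
  have hlt : ∀ r, {y : EuclideanSpace ℝ (Fin 2) | ‖y‖ ^ 2 < r}
      = {y | ‖(0 : EuclideanSpace ℝ (Fin 2)) - y‖ ^ 2 < r} := fun r ↦ by simp
  have hkey : ∀ a b : ℝ, a < b →
      (volume : Measure (EuclideanSpace ℝ (Fin 2))).map (fun y ↦ ‖y‖ ^ 2) (Ico a b)
        = (ENNReal.ofReal Real.pi • volume.restrict (Ici (0 : ℝ))) (Ico a b) := by
    intro a b hab
    have h1 : (fun y : EuclideanSpace ℝ (Fin 2) ↦ ‖y‖ ^ 2) ⁻¹' Ico a b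
        = {y | ‖y‖ ^ 2 < b} \ {y | ‖y‖ ^ 2 < a} := by
      ext y
      simp [and_comm]
    have h2 : Ico a b ∩ Ici 0 = Ico (max a 0) b := by
      ext t
      simp only [mem_inter_iff, mem_Ico, mem_Ici, max_le_iff]
      tauto
    rw [Measure.map_apply hm measurableSet_Ico, h1, measure_sdiff
      (show {y : EuclideanSpace ℝ (Fin 2) | ‖y‖ ^ 2 < a} ⊆ {y | ‖y‖ ^ 2 < b} from
        fun y hy ↦ lt_trans hy hab) (measurableSet_lt hm measurable_const).nullMeasurableSet
      (by rw [hlt, volume_norm_sq_lt]; finiteness), hlt, hlt, volume_norm_sq_lt,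
      volume_norm_sq_lt, Measure.smul_apply, Measure.restrict_apply measurableSet_Ico, h2,
      Real.volume_Ico, smul_eq_mul, ← ENNReal.mul_sub (fun _ _ ↦ by finiteness),
      ENNReal.ofReal_sub _ (le_max_right a 0)]
    congr 2
    rcases le_total a 0 with ha | ha
    · simp [ha, ENNReal.ofReal_of_nonpos ha]
    · simp [ha]
  refine Measure.ext_of_Ico' _ _ (fun a b hab ↦ ?_) hkey
  rw [hkey a b hab, Measure.smul_apply, smul_eq_mul]
  exact ENNReal.mul_ne_top ENNReal.ofReal_ne_top
    ((Measure.restrict_apply_le _ _).trans_lt measure_Ico_lt_top).ne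

lemma lintegral_comp_norm_sq {g : ℝ → ℝ≥0∞} (hg : Measurable g) :
    ∫⁻ y : EuclideanSpace ℝ (Fin 2), g (‖y‖ ^ 2)
      = ENNReal.ofReal Real.pi * ∫⁻ u in Ici (0 : ℝ), g u := by
  rw [← lintegral_map hg (by fun_prop), map_norm_sq_volume, lintegral_smul_measure, smul_eq_mul]

instance sigmaFinite_comap_val (𝔽 : Measure ℝ) [SigmaFinite 𝔽] :
    SigmaFinite (𝔽.comap (Subtype.val : Ioi (0 : ℝ) → ℝ)) := by
  refine SigmaFinite.of_map _ measurable_subtype_coe.aemeasurable ?_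
  rw [(MeasurableEmbedding.subtype_coe measurableSet_Ioi).map_comap]
  infer_instance

instance sigmaFinite_weightedIntensity (d : ℕ) (𝔽 : Measure ℝ) [SigmaFinite 𝔽] :
    SigmaFinite (weightedIntensity d 𝔽) := by
  unfold weightedIntensity
  infer_instance

lemma weightedIntensity_powerDist_lt (𝔽 : Measure ℝ) [IsLocallyFiniteMeasure 𝔽]
    (y : EuclideanSpace ℝ (Fin 2)) {s : ℝ} (hs : 0 ≤ s) :
    weightedIntensity 2 𝔽 {q | powerDist y q < s}
      = ENNReal.ofReal (Real.pi * ∫ t in (0 : ℝ)..s, weightCDF 𝔽 t) := by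
  have hsec : ∀ h : Ioi (0 : ℝ), (fun x ↦ (x, h)) ⁻¹' {q | powerDist y q < s}
      = {x | ‖y - x‖ ^ 2 < s - h} := by
    intro h
    ext x
    simp [powerDist, lt_sub_iff_add_lt]
  rw [weightedIntensity, Measure.prod_apply_symm
    (measurableSet_lt (measurable_powerDist y) measurable_const)]
  simp_rw [hsec, volume_norm_sq_lt]
  rw [lintegral_subtype_comap measurableSet_Ioi
    (fun h ↦ ENNReal.ofReal Real.pi * ENNReal.ofReal (s - h)),
    lintegral_const_mul _ (by fun_prop), lintegral_sub_eq_integral_weightCDF 𝔽 hs,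
    ENNReal.ofReal_mul Real.pi_pos.le]

lemma weightedIntensity_powerDist_lt_lt_top (𝔽 : Measure ℝ) [IsLocallyFiniteMeasure 𝔽]
    (y : EuclideanSpace ℝ (Fin 2)) (s : ℝ) :
    weightedIntensity 2 𝔽 {q | powerDist y q < s} < ∞ := by
  refine (measure_mono fun q hq ↦ lt_of_lt_of_le hq (le_max_left s 0)).trans_lt
    ((weightedIntensity_powerDist_lt 𝔽 y (le_max_right s 0)).trans_lt ENNReal.ofReal_lt_top)

/-! ### The void probability of a paraboloid -/

/-- `exp (-π ∫₀ᵘ F)`: for `u ≥ 0`, the probability that no point of the process has power distance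
less than `u` to a given point of the plane. -/
noncomputable def paraboloidVoid (𝔽 : Measure ℝ) (u : ℝ) : ℝ :=
  Real.exp (-Real.pi * ∫ t in (0 : ℝ)..u, weightCDF 𝔽 t)

section Void

variable (𝔽 : Measure ℝ)

lemma paraboloidVoid_nonneg (u : ℝ) : 0 ≤ paraboloidVoid 𝔽 u := (Real.exp_pos _).le

lemma paraboloidVoid_le_one {u : ℝ} (hu : 0 ≤ u) : paraboloidVoid 𝔽 u ≤ 1 := by
  rw [paraboloidVoid, Real.exp_le_one_iff, neg_mul]
  exact neg_nonpos.2 (mul_nonneg Real.pi_pos.le (integral_weightCDF_nonneg 𝔽 hu))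

variable [IsLocallyFiniteMeasure 𝔽]

lemma continuous_paraboloidVoid : Continuous (paraboloidVoid 𝔽) :=
  Real.continuous_exp.comp (continuous_const.mul (continuous_integral_weightCDF 𝔽))

lemma expNeg_weightedIntensity_powerDist_lt (y : EuclideanSpace ℝ (Fin 2)) {s : ℝ} (hs : 0 ≤ s) :
    expNeg (weightedIntensity 2 𝔽 {q | powerDist y q < s})
      = ENNReal.ofReal (paraboloidVoid 𝔽 s) := by
  rw [weightedIntensity_powerDist_lt 𝔽 y hs, expNeg, paraboloidVoid, ENNReal.toReal_ofReal
    (mul_nonneg Real.pi_pos.le (integral_weightCDF_nonneg 𝔽 hs)), neg_mul]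

/-- The fundamental theorem of calculus applies although `F` may jump: it is monotone, so it has
only countably many discontinuities. -/
lemma integral_weightCDF_mul_paraboloidVoid {z : ℝ} (hz : 0 ≤ z) :
    IntegrableOn (fun u ↦ Real.pi * (paraboloidVoid 𝔽 u * weightCDF 𝔽 u)) (Ioc 0 z) ∧
    ∫ u in Ioc 0 z, Real.pi * (paraboloidVoid 𝔽 u * weightCDF 𝔽 u)
      = 1 - paraboloidVoid 𝔽 z := by
  have hint : IntervalIntegrable (fun u ↦ Real.pi * (paraboloidVoid 𝔽 u * weightCDF 𝔽 u))
      volume 0 z :=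
    ((intervalIntegrable_weightCDF 𝔽 0 z).continuousOn_mul
      (continuous_paraboloidVoid 𝔽).continuousOn).const_mul _
  refine ⟨hint.1, ?_⟩
  rw [← intervalIntegral.integral_of_le hz]
  have h := integral_eq_of_hasDerivAt_off_countable (a := 0) (b := z)
    (fun u ↦ -paraboloidVoid 𝔽 u) _ (monotone_weightCDF 𝔽).countable_not_continuousAt
    (continuous_paraboloidVoid 𝔽).neg.continuousOn (fun u hu ↦ ?_) hint
  · rw [h]
    simp [paraboloidVoid]
    ring
  · have hc : ContinuousAt (weightCDF 𝔽) u := by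
      by_contra hc
      exact hu.2 hc
    have hI : HasDerivAt (fun u ↦ ∫ t in (0 : ℝ)..u, weightCDF 𝔽 t) (weightCDF 𝔽 u) u :=
      intervalIntegral.integral_hasDerivAt_right (intervalIntegrable_weightCDF 𝔽 0 u)
        (monotone_weightCDF 𝔽).measurable.stronglyMeasurable.stronglyMeasurableAtFilter hc
    refine ((hI.const_mul (-Real.pi)).exp).neg.congr_deriv ?_
    simp only [paraboloidVoid]
    ring

lemma lintegral_weightCDF_mul_paraboloidVoid {z : ℝ} (hz : 0 ≤ z) :
    ENNReal.ofReal Real.pi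
        * ∫⁻ u in Ioc 0 z, ENNReal.ofReal (paraboloidVoid 𝔽 u) * 𝔽 (Ioc 0 u)
      = ENNReal.ofReal (1 - paraboloidVoid 𝔽 z) := by
  obtain ⟨hint, heq⟩ := integral_weightCDF_mul_paraboloidVoid 𝔽 hz
  rw [← heq, ofReal_integral_eq_lintegral_ofReal hint (ae_of_all _ fun u ↦
    mul_nonneg Real.pi_pos.le (mul_nonneg (paraboloidVoid_nonneg 𝔽 u) (weightCDF_nonneg 𝔽 u))),
    ← lintegral_const_mul' _ _ ENNReal.ofReal_ne_top]
  refine lintegral_congr fun u ↦ ?_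
  rw [ENNReal.ofReal_mul Real.pi_pos.le, ENNReal.ofReal_mul (paraboloidVoid_nonneg 𝔽 u),
    ofReal_weightCDF]

variable {𝔽}

/-- Since `F` is eventually bounded below by a positive constant, the void probability decays
exponentially. -/
lemma exists_paraboloidVoid_le (h𝔽pos : 𝔽 (Iic 0) = 0) (h𝔽ne : 𝔽 ≠ 0) :
    ∃ b > 0, ∃ C, ∀ u, 0 ≤ u → paraboloidVoid 𝔽 u ≤ C * Real.exp (-b * u) := by
  obtain ⟨a, ha⟩ : ∃ a : ℕ, 𝔽 (Ioc 0 (a : ℝ)) ≠ 0 := by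
    by_contra! h
    refine h𝔽ne (Measure.measure_univ_eq_zero.1 (measure_mono_null ?_
      (measure_union_null h𝔽pos (measure_iUnion_null h))))
    intro x _
    rcases le_or_gt x 0 with hx | hx
    · exact Or.inl hx
    · obtain ⟨n, hn⟩ := exists_nat_ge x
      exact Or.inr (mem_iUnion.2 ⟨n, hx, hn⟩)
  have hc : 0 < weightCDF 𝔽 a := ENNReal.toReal_pos ha measure_Ioc_lt_top.ne
  set c := weightCDF 𝔽 a with hcdef
  refine ⟨Real.pi * c, by positivity, Real.exp (Real.pi * c * a), fun u hu ↦ ?_⟩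
  have hI : c * (u - a) ≤ ∫ t in (0 : ℝ)..u, weightCDF 𝔽 t := by
    rcases le_total u a with hua | hua
    · exact (mul_nonpos_of_nonneg_of_nonpos hc.le (sub_nonpos.2 hua)).trans
        (integral_weightCDF_nonneg 𝔽 hu)
    · rw [← intervalIntegral.integral_add_adjacent_intervals
        (intervalIntegrable_weightCDF 𝔽 0 a) (intervalIntegrable_weightCDF 𝔽 a u)]
      have h1 := intervalIntegral.integral_mono_on hua intervalIntegrable_const
        (intervalIntegrable_weightCDF 𝔽 a u) (f := fun _ ↦ c)
        (fun t ht ↦ monotone_weightCDF 𝔽 ht.1)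
      rw [intervalIntegral.integral_const, smul_eq_mul, mul_comm] at h1
      linarith [integral_weightCDF_nonneg 𝔽 (Nat.cast_nonneg (α := ℝ) a)]
  rw [paraboloidVoid, ← Real.exp_add, Real.exp_le_exp]
  nlinarith [mul_le_mul_of_nonneg_left hI Real.pi_pos.le]

lemma tendsto_paraboloidVoid (h𝔽pos : 𝔽 (Iic 0) = 0) (h𝔽ne : 𝔽 ≠ 0) :
    Tendsto (paraboloidVoid 𝔽) atTop (𝓝 0) := by
  obtain ⟨b, hb, C, hC⟩ := exists_paraboloidVoid_le h𝔽pos h𝔽ne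
  refine tendsto_of_tendsto_of_tendsto_of_le_of_le' tendsto_const_nhds ?_
    (Eventually.of_forall (paraboloidVoid_nonneg 𝔽)) ((eventually_ge_atTop 0).mono hC)
  rw [← mul_zero C]
  refine (Real.tendsto_exp_atBot.comp ?_).const_mul C
  exact tendsto_id.const_mul_atTop_of_neg (neg_neg_of_pos hb)

lemma integrableOn_paraboloidVoid (h𝔽pos : 𝔽 (Iic 0) = 0) (h𝔽ne : 𝔽 ≠ 0) {z : ℝ}
    (hz : 0 ≤ z) : IntegrableOn (paraboloidVoid 𝔽) (Ioi z) := by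
  obtain ⟨b, hb, C, hC⟩ := exists_paraboloidVoid_le h𝔽pos h𝔽ne
  refine ((exp_neg_integrableOn_Ioi z hb).const_mul C).mono'
    (continuous_paraboloidVoid 𝔽).aestronglyMeasurable ?_
  filter_upwards [ae_restrict_mem measurableSet_Ioi] with u hu
  rw [Real.norm_of_nonneg (paraboloidVoid_nonneg 𝔽 u)]
  exact hC u (hz.trans hu.le)

end Void

/-! ### The density of the volume-biased weight distribution -/

section Density

variable (𝔽 : Measure ℝ)

/-- The expected area `π ∫ₕ^∞ exp (-π ∫₀ᵘ F) du` of the cell of an additional point of weight `h`,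
which is the density of the volume-biased weight distribution with respect to `𝔽`. -/
noncomputable def meanCellArea (h : ℝ) : ℝ≥0∞ :=
  ENNReal.ofReal Real.pi * ∫⁻ u in Ici h, ENNReal.ofReal (paraboloidVoid 𝔽 u)

lemma measurable_meanCellArea : Measurable (meanCellArea 𝔽) := by
  refine Measurable.const_mul (Antitone.measurable fun a b hab ↦ ?_) _
  exact lintegral_mono_set (Ici_subset_Ici.2 hab)

variable [IsLocallyFiniteMeasure 𝔽]

lemma lintegral_paraboloidVoid_powerDist (p : WeightedPoint 2) :
    ∫⁻ y, ENNReal.ofReal (paraboloidVoid 𝔽 (powerDist y p)) = meanCellArea 𝔽 p.2 := by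
  have hG : Measurable fun u ↦ ENNReal.ofReal (paraboloidVoid 𝔽 u) :=
    (continuous_paraboloidVoid 𝔽).measurable.ennreal_ofReal
  have h1 := lintegral_sub_right_eq_self (μ := (volume : Measure (EuclideanSpace ℝ (Fin 2))))
    (fun y ↦ ENNReal.ofReal (paraboloidVoid 𝔽 (‖y‖ ^ 2 + p.2))) p.1
  have h2 := lintegral_comp_norm_sq (hG.comp (measurable_add_const (p.2 : ℝ)))
  have h3 := lintegral_add_right_eq_self (μ := (volume : Measure ℝ))
    ((Ici (p.2 : ℝ)).indicator fun u ↦ ENNReal.ofReal (paraboloidVoid 𝔽 u)) p.2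
  rw [meanCellArea, ← lintegral_indicator measurableSet_Ici, ← h3]
  refine h1.trans (h2.trans ?_)
  rw [← lintegral_indicator measurableSet_Ici]
  congr 2 with u
  simp [indicator]

/-- Each point of a set `A` of weights contributes at level `u` once `u` exceeds the weight. -/
lemma lintegral_meanCellArea (A : Set ℝ) :
    ∫⁻ h in A, meanCellArea 𝔽 h ∂𝔽 = ENNReal.ofReal Real.pi *
      ∫⁻ u, ENNReal.ofReal (paraboloidVoid 𝔽 u) * 𝔽 (Iic u ∩ A) := by
  have hG : Measurable fun u ↦ ENNReal.ofReal (paraboloidVoid 𝔽 u) :=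
    (continuous_paraboloidVoid 𝔽).measurable.ennreal_ofReal
  have hjoint : Measurable (Function.uncurry fun h u : ℝ ↦
      (Ici h).indicator (fun u ↦ ENNReal.ofReal (paraboloidVoid 𝔽 u)) u) :=
    (hG.comp measurable_snd).indicator (measurableSet_le measurable_fst measurable_snd :
      MeasurableSet {z : ℝ × ℝ | z.1 ≤ z.2})
  unfold meanCellArea
  simp_rw [← lintegral_indicator measurableSet_Ici]
  rw [lintegral_const_mul' _ _ ENNReal.ofReal_ne_top, lintegral_lintegral_swap
    hjoint.aemeasurable]
  congr 1
  refine lintegral_congr fun u ↦ ?_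
  have h1 : (fun h ↦ (Ici h).indicator (fun u ↦ ENNReal.ofReal (paraboloidVoid 𝔽 u)) u)
      = (Iic u).indicator fun _ ↦ ENNReal.ofReal (paraboloidVoid 𝔽 u) := by
    ext h
    simp [indicator]
  rw [h1, lintegral_indicator_const measurableSet_Iic, Measure.restrict_apply measurableSet_Iic]

lemma lintegral_meanCellArea_univ (h𝔽pos : 𝔽 (Iic 0) = 0) (h𝔽ne : 𝔽 ≠ 0) :
    ∫⁻ h, meanCellArea 𝔽 h ∂𝔽 = 1 := by
  have hIic : ∀ u, 𝔽 (Iic u) = 𝔽 (Ioc 0 u) := fun u ↦ by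
    refine le_antisymm ?_ (measure_mono fun x hx ↦ hx.2)
    calc 𝔽 (Iic u) ≤ 𝔽 (Iic 0 ∪ Ioc 0 u) := measure_mono fun x hx ↦
          (le_or_gt x 0).imp id fun h ↦ ⟨h, hx⟩
      _ ≤ _ := (measure_union_le _ _).trans (by rw [h𝔽pos, zero_add])
  have hlim : Tendsto (fun n : ℕ ↦ ENNReal.ofReal (1 - paraboloidVoid 𝔽 n)) atTop (𝓝 1) := by
    rw [← ENNReal.ofReal_one]
    refine (ENNReal.continuous_ofReal.tendsto _).comp ?_
    simpa using ((tendsto_paraboloidVoid h𝔽pos h𝔽ne).comp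
      tendsto_natCast_atTop_atTop).const_sub 1
  have hU : ⋃ n : ℕ, Ioc (0 : ℝ) n = Ioi 0 := by
    ext x
    simp only [mem_iUnion, mem_Ioc, mem_Ioi]
    exact ⟨fun ⟨_, h, _⟩ ↦ h, fun h ↦ (exists_nat_ge x).imp fun n hn ↦ ⟨h, hn⟩⟩
  have hmono : Monotone fun n : ℕ ↦ Ioc (0 : ℝ) n := fun m n hmn ↦
    Ioc_subset_Ioc_right (Nat.cast_le.2 hmn)
  rw [← setLIntegral_univ, lintegral_meanCellArea 𝔽 univ]
  simp_rw [inter_univ, hIic]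
  have hsupp : (fun u ↦ ENNReal.ofReal (paraboloidVoid 𝔽 u) * 𝔽 (Ioc 0 u))
      = (Ioi 0).indicator fun u ↦ ENNReal.ofReal (paraboloidVoid 𝔽 u) * 𝔽 (Ioc 0 u) := by
    ext u
    by_cases hu : 0 < u
    · simp [hu]
    · simp [hu]
  rw [hsupp, lintegral_indicator measurableSet_Ioi, ← hU]
  refine tendsto_nhds_unique (ENNReal.Tendsto.const_mul ?_ (Or.inr ENNReal.ofReal_ne_top))
    (hlim.congr fun n ↦ (lintegral_weightCDF_mul_paraboloidVoid 𝔽 (Nat.cast_nonneg n)).symm)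
  have := tendsto_measure_iUnion_atTop (μ := volume.withDensity fun u ↦
    ENNReal.ofReal (paraboloidVoid 𝔽 u) * 𝔽 (Ioc 0 u)) hmono
  simpa only [withDensity_apply' _ _, Function.comp_def] using this

lemma lintegral_meanCellArea_Ioc (h𝔽pos : 𝔽 (Iic 0) = 0) (h𝔽ne : 𝔽 ≠ 0) {z : ℝ}
    (hz : 0 ≤ z) :
    ∫⁻ h in Ioc 0 z, meanCellArea 𝔽 h ∂𝔽 = ENNReal.ofReal (1 - paraboloidVoid 𝔽 z +
      Real.pi * weightCDF 𝔽 z * ∫ u in Ioi z, paraboloidVoid 𝔽 u) := by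
  have hsupp : (fun u ↦ ENNReal.ofReal (paraboloidVoid 𝔽 u) * 𝔽 (Iic u ∩ Ioc 0 z))
      = (Ioi 0).indicator fun u ↦
        ENNReal.ofReal (paraboloidVoid 𝔽 u) * 𝔽 (Iic u ∩ Ioc 0 z) := by
    ext u
    by_cases hu : 0 < u
    · simp [hu]
    · have : Iic u ∩ Ioc 0 z = ∅ :=
        eq_empty_of_forall_notMem fun x hx ↦ hu (hx.2.1.trans_le hx.1)
      simp [hu, this]
  have hlow : ∫⁻ u in Ioc 0 z, ENNReal.ofReal (paraboloidVoid 𝔽 u) * 𝔽 (Iic u ∩ Ioc 0 z)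
      = ∫⁻ u in Ioc 0 z, ENNReal.ofReal (paraboloidVoid 𝔽 u) * 𝔽 (Ioc 0 u) := by
    refine setLIntegral_congr_fun measurableSet_Ioc fun u hu ↦ ?_
    have : Iic u ∩ Ioc 0 z = Ioc 0 u := by
      ext x
      exact ⟨fun h ↦ ⟨h.2.1, h.1⟩, fun h ↦ ⟨h.2, h.1, h.2.trans hu.2⟩⟩
    simp only [this]
  have hhigh : ∫⁻ u in Ioi z, ENNReal.ofReal (paraboloidVoid 𝔽 u) * 𝔽 (Iic u ∩ Ioc 0 z)
      = ENNReal.ofReal (weightCDF 𝔽 z) * ENNReal.ofReal (∫ u in Ioi z, paraboloidVoid 𝔽 u) := by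
    rw [ofReal_integral_eq_lintegral_ofReal (integrableOn_paraboloidVoid h𝔽pos h𝔽ne hz)
      (ae_of_all _ (paraboloidVoid_nonneg 𝔽)), ← lintegral_const_mul' _ _ ENNReal.ofReal_ne_top]
    refine setLIntegral_congr_fun measurableSet_Ioi fun u hu ↦ ?_
    have : Iic u ∩ Ioc 0 z = Ioc 0 z :=
      inter_eq_right.2 fun x hx ↦ hx.2.trans (le_of_lt hu)
    simp only [this, ofReal_weightCDF, mul_comm]
  rw [lintegral_meanCellArea 𝔽 (Ioc 0 z), hsupp, lintegral_indicator measurableSet_Ioi,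
    ← Ioc_union_Ioi_eq_Ioi hz, lintegral_union measurableSet_Ioi
      (Set.disjoint_left.2 fun x hx hx' ↦ not_lt.2 hx.2 hx'), hlow, hhigh, mul_add,
    lintegral_weightCDF_mul_paraboloidVoid 𝔽 hz, ENNReal.ofReal_add (sub_nonneg.2 (paraboloidVoid_le_one 𝔽 hz))
      (mul_nonneg (mul_nonneg Real.pi_pos.le (weightCDF_nonneg 𝔽 z))
        (integral_nonneg (paraboloidVoid_nonneg 𝔽))), mul_assoc Real.pi,
    ENNReal.ofReal_mul Real.pi_pos.le, ENNReal.ofReal_mul (weightCDF_nonneg 𝔽 z)]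

lemma setLIntegral_weightedIntensity_snd (h𝔽pos : 𝔽 (Iic 0) = 0) {A : Set ℝ}
    (hA : MeasurableSet A) {K : ℝ → ℝ≥0∞} (hK : Measurable K) :
    ∫⁻ p in {p : WeightedPoint 2 | p.1 ∈ unitCube 2 ∧ (p.2 : ℝ) ∈ A}, K p.2
        ∂(weightedIntensity 2 𝔽) = ∫⁻ h in A, K h ∂𝔽 := by
  have hA' : MeasurableSet (Subtype.val ⁻¹' A : Set (Ioi (0 : ℝ))) := measurable_subtype_coe hA
  have hB : {p : WeightedPoint 2 | p.1 ∈ unitCube 2 ∧ (p.2 : ℝ) ∈ A}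
      = unitCube 2 ×ˢ (Subtype.val ⁻¹' A : Set (Ioi (0 : ℝ))) := rfl
  have h𝔽 : 𝔽.restrict (Ioi 0) = 𝔽 := by
    rw [Measure.restrict_eq_self_of_ae_mem]
    filter_upwards [measure_eq_zero_iff_ae_notMem.1 h𝔽pos] with x hx
    simpa using hx
  rw [hB, weightedIntensity, ← Measure.prod_restrict]
  have h1 := lintegral_prod_mul (μ := volume.restrict (unitCube 2))
    (ν := (𝔽.comap (Subtype.val : Ioi (0 : ℝ) → ℝ)).restrict (Subtype.val ⁻¹' A))
    (f := fun _ ↦ 1) (g := fun h ↦ K h) measurable_const.aemeasurable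
    (hK.comp measurable_subtype_coe).aemeasurable
  simp only [one_mul, lintegral_const, Measure.restrict_apply MeasurableSet.univ, univ_inter,
    volume_unitCube] at h1
  rw [h1, ← lintegral_indicator hA']
  refine (lintegral_subtype_comap measurableSet_Ioi (A.indicator K)).trans ?_
  rw [h𝔽, lintegral_indicator hA]

/-- The volume-biased weight distribution has density `meanCellArea 𝔽` with respect to `𝔽`. -/
theorem volumeBiasedWeight_eq_lintegral {Ω : Type*} [MeasurableSpace Ω] {P : Measure Ω}
    [IsProbabilityMeasure P] (h𝔽pos : 𝔽 (Iic 0) = 0) {η : Ω → CountingConfig (WeightedPoint 2)}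
    (hη : IsPoissonProcess η (weightedIntensity 2 𝔽) P) {A : Set ℝ} (hA : MeasurableSet A) :
    volumeBiasedWeight η P A = ∫⁻ h in A, meanCellArea 𝔽 h ∂𝔽 := by
  set B : Set (WeightedPoint 2) := {p | p.1 ∈ unitCube 2 ∧ (p.2 : ℝ) ∈ A}
  have hB : MeasurableSet B := (measurable_fst (measurableSet_unitCube 2)).inter
    ((measurable_subtype_coe.comp measurable_snd) hA)
  have hg : Measurable (({0} : Set ℝ≥0∞).indicator (1 : ℝ≥0∞ → ℝ≥0∞)) :=
    measurable_one.indicator (measurableSet_singleton 0)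
  have hT : Measurable fun z : EuclideanSpace ℝ (Fin 2) × WeightedPoint 2 ↦ powerDist z.1 z.2 :=
    continuous_powerDist.measurable
  have hG : Measurable fun u ↦ ENNReal.ofReal (paraboloidVoid 𝔽 u) :=
    (continuous_paraboloidVoid 𝔽).measurable.ennreal_ofReal
  have hsf := isSFiniteKernel_configKernel hη.measurable
  have hsf' : ∀ ω, SFinite (η ω : Measure (WeightedPoint 2)) := fun ω ↦
    inferInstanceAs (SFinite (configKernel hη.measurable ω))
  calc volumeBiasedWeight η P A
      = ∫⁻ ω, ∫⁻ p in B, volume (laguerreCell p (η ω).points) ∂(η ω : Measure _) ∂P := by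
        unfold volumeBiasedWeight CountingConfig.sumOver
        refine lintegral_congr fun ω ↦ ?_
        rw [← lintegral_indicator hB]
        refine lintegral_congr fun p ↦ ?_
        by_cases h1 : p.1 ∈ unitCube 2 <;> by_cases h2 : (p.2 : ℝ) ∈ A <;> simp [B, h1, h2]
    _ = ∫⁻ ω, ∫⁻ p in B, ∫⁻ y, ({0} : Set ℝ≥0∞).indicator 1
          ((η ω : Measure _) {q | powerDist y q < powerDist y p}) ∂volume ∂(η ω : Measure _) ∂P := by
        simp_rw [volume_laguerreCell_points]
    _ = ∫⁻ ω, ∫⁻ y, ∫⁻ p in B, ({0} : Set ℝ≥0∞).indicator 1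
          ((η ω : Measure _) {q | powerDist y q < powerDist y p})
            ∂(η ω : Measure _) ∂volume ∂P := by
        refine lintegral_congr fun ω ↦ lintegral_lintegral_swap (Measurable.aemeasurable ?_)
        exact (hg.comp (measurable_config_lt hη.measurable hT)).comp
          (by fun_prop : Measurable fun z : WeightedPoint 2 × EuclideanSpace ℝ (Fin 2) ↦
            ((ω, z.2), z.1))
    _ = ∫⁻ y, ∫⁻ ω, ∫⁻ p in B, ({0} : Set ℝ≥0∞).indicator 1
          ((η ω : Measure _) {q | powerDist y q < powerDist y p}) ∂(η ω : Measure _) ∂P :=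
        lintegral_lintegral_swap
          (measurable_lintegral_minimal_points hη.measurable hT hB).aemeasurable
    _ = ∫⁻ y, ∫⁻ p in B, ENNReal.ofReal (paraboloidVoid 𝔽 (powerDist y p))
          ∂(weightedIntensity 2 𝔽) := by
        refine lintegral_congr fun y ↦ ?_
        rw [hη.lintegral_minimal_points_of_sigmaFinite (measurable_powerDist y)
          (weightedIntensity_powerDist_lt_lt_top 𝔽 y) hB]
        refine lintegral_congr fun p ↦ expNeg_weightedIntensity_powerDist_lt 𝔽 y ?_
        exact add_nonneg (sq_nonneg _) (le_of_lt p.2.2)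
    _ = ∫⁻ p in B, ∫⁻ y, ENNReal.ofReal (paraboloidVoid 𝔽 (powerDist y p))
          ∂volume ∂(weightedIntensity 2 𝔽) :=
        lintegral_lintegral_swap
          (f := fun y p ↦ ENNReal.ofReal (paraboloidVoid 𝔽 (powerDist y p)))
          (hG.comp hT).aemeasurable
    _ = ∫⁻ p in B, meanCellArea 𝔽 p.2 ∂(weightedIntensity 2 𝔽) := by
        simp_rw [lintegral_paraboloidVoid_powerDist]
    _ = ∫⁻ h in A, meanCellArea 𝔽 h ∂𝔽 :=
        setLIntegral_weightedIntensity_snd 𝔽 h𝔽pos hA (measurable_meanCellArea 𝔽)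

end Density

theorem mainTheorem8 {Ω : Type*} [MeasurableSpace Ω] (P : Measure Ω) [IsProbabilityMeasure P]
    (𝔽 : Measure ℝ) [IsLocallyFiniteMeasure 𝔽] (h𝔽pos : 𝔽 (Iic 0) = 0) (h𝔽ne : 𝔽 ≠ 0)
    (η : Ω → CountingConfig (WeightedPoint 2))
    (hη : IsPoissonProcess η (weightedIntensity 2 𝔽) P) :
    (∃ Q : Measure ℝ, IsProbabilityMeasure Q ∧
      ∀ A : Set ℝ, MeasurableSet A → Q A = volumeBiasedWeight η P A) ∧
    ∀ z : ℝ, 0 ≤ z →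
      IntegrableOn (fun u : ℝ => Real.exp (-Real.pi * ∫ t in (0 : ℝ)..u, weightCDF 𝔽 t))
        (Ioi z) ∧
      volumeBiasedCDF η P z =
        1 - Real.exp (-Real.pi * ∫ t in (0 : ℝ)..z, weightCDF 𝔽 t) +
          Real.pi * weightCDF 𝔽 z *
            ∫ u in Ioi z, Real.exp (-Real.pi * ∫ t in (0 : ℝ)..u, weightCDF 𝔽 t) := by
  refine ⟨⟨𝔽.withDensity (meanCellArea 𝔽), ⟨?_⟩, fun A hA ↦ ?_⟩, fun z hz ↦ ⟨?_, ?_⟩⟩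
  · rw [withDensity_apply _ MeasurableSet.univ, setLIntegral_univ]
    exact lintegral_meanCellArea_univ 𝔽 h𝔽pos h𝔽ne
  · rw [withDensity_apply _ hA, volumeBiasedWeight_eq_lintegral 𝔽 h𝔽pos hη hA]
  · exact integrableOn_paraboloidVoid h𝔽pos h𝔽ne hz
  · rw [volumeBiasedCDF, volumeBiasedWeight_eq_lintegral 𝔽 h𝔽pos hη measurableSet_Ioc,
      lintegral_meanCellArea_Ioc 𝔽 h𝔽pos h𝔽ne hz]
    refine ENNReal.toReal_ofReal (add_nonneg (sub_nonneg.2 ?_) (mul_nonneg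
      (mul_nonneg Real.pi_pos.le (weightCDF_nonneg 𝔽 z))
      (integral_nonneg (paraboloidVoid_nonneg 𝔽))))
    exact paraboloidVoid_le_one 𝔽 hz
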